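/- Let $\Omega\subset\mathbb{R}^2$ be open, bounded and connected, write $\mathbf{x}=(x,y)$ for its points, and let $x_{\min}=\inf_{(x,y)\in\Omega}x$. Assume that there is exactly one point $A_0\in\partial\Omega$ whose first coordinate equals $x_{\min}$, that $\partial\Omega$ is smooth near $A_0$, and that the curvature $\kappa_0$ of $\partial\Omega$ at $A_0$ is positive. (Here, if $\gamma$ is a counterclockwise parametrization by arc length of $\partial\Omega$ near $A_0=\gamma(0)$ and $\boldsymbol n$ is the outward unit normal, $\kappa_0$ is defined by $\gamma''(0)=-\kappa_0\,\boldsymbol n(0)$.) For $h>0$ let $\mathscr{L}_h=-h^2(\partial_x^2+\partial_y^2)+x$ be the Dirichlet realization of the Stark Hamiltonian in $L^2(\Omega)$, that is, the self-adjoint operator associated with the quadratic form $$\mathscr{Q}_h(\varphi)=h^2\int_\Omega|\nabla\varphi|^2\,\mathrm{d}\mathbf{x}+\int_\Omega x|\varphi|^2\,\mathrm{d}\mathbf{x},\qquad \varphi\in H^1_0(\Omega).$$ Proposition. Let $M>0$. There exist $\varepsilon,C,h_0>0$ such that, for all $h\in(0,h_0)$, for all eigenvalues $\lambda$ of $\mathscr{L}_h$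 such that $\lambda\le x_{\min}+Mh^{2/3}$, and all corresponding eigenfunctions $\psi$, $$\int_\Omega e^{\varepsilon|x-x_{\min}|^{3/2}/h}\,|\psi|^2\,\mathrm{d}\mathbf{x}\le C\|\psi\|^2$$ and $$\int_\Omega e^{\varepsilon|x-x_{\min}|^{3/2}/h}\,|h\nabla\psi|^2\,\mathrm{d}\mathbf{x}\le Ch^{2/3}\|\psi\|^2,$$ where $\|\cdot\|$ is the norm of $L^2(\Omega)$. -/

import Mathlib

open MeasureTheory Set Filter Topology
open scoped ContDiff

noncomputable section

namespace Stark

/-! ### The class of domains -/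

/-- The Euclidean plane; a point `p` has coordinates `x = p 0` and `y = p 1`. -/
abbrev Plane : Type := EuclideanSpace ℝ (Fin 2)

/-- `x_min`, the infimum of the first coordinate over `Ω`. -/
def xMin (Ω : Set Plane) : ℝ := sInf ((fun p : Plane => p 0) '' Ω)

/-- A domain: open, bounded and connected (in particular nonempty). -/
structure IsBoundedDomain (Ω : Set Plane) : Prop where
  isOpen : IsOpen Ω
  isBounded : Bornology.IsBounded Ω
  isConnected : IsConnected Ω

/-- The boundary of `Ω` is smooth near the boundary point `A`: near `A`, the set `Ω` is the
superlevel set `{ρ > 0}` of a smooth function `ρ` without critical points. -/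
def HasSmoothBoundaryNear (Ω : Set Plane) (A : Plane) : Prop :=
  A ∈ frontier Ω ∧ ∃ (U : Set Plane) (ρ : Plane → ℝ), IsOpen U ∧ A ∈ U ∧ ContDiffOn ℝ ∞ ρ U ∧
    (∀ p ∈ U, fderiv ℝ ρ p ≠ 0) ∧ ∀ p ∈ U, p ∈ Ω ↔ 0 < ρ p

/-- The vector `γ'(s)` rotated clockwise by a right angle: this is the outward unit normal
when `γ` is a counterclockwise parametrization by arc length. -/
def rightNormal (γ : ℝ → Plane) (s : ℝ) : Plane := !₂[deriv γ s 1, -(deriv γ s 0)]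

/-- `γ`, on `(-δ, δ)`, is a smooth counterclockwise parametrization by arc length of the boundary
of `Ω` near `A = γ 0`. Counterclockwise means that `rightNormal γ` points out of `Ω`. -/
structure IsBoundaryParam (Ω : Set Plane) (A : Plane) (γ : ℝ → Plane) (δ : ℝ) : Prop where
  pos : 0 < δ
  smooth : ContDiffOn ℝ ∞ γ (Ioo (-δ) δ)
  base : γ 0 = A
  mem_frontier : ∀ s ∈ Ioo (-δ) δ, γ s ∈ frontier Ω
  unit_speed : ∀ s ∈ Ioo (-δ) δ, ‖deriv γ s‖ = 1
  inward : ∀ s ∈ Ioo (-δ) δ, ∀ᶠ t in 𝓝[>] (0 : ℝ), γ s - t • rightNormal γ s ∈ Ω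
  outward : ∀ s ∈ Ioo (-δ) δ, ∀ᶠ t in 𝓝[>] (0 : ℝ), γ s + t • rightNormal γ s ∉ Ω

/-- The boundary of `Ω` has curvature `κ` at `A`, through the relation `γ'' = -κ n`, where `n`
is the outward unit normal. -/
def HasBoundaryCurvature (Ω : Set Plane) (A : Plane) (κ : ℝ) : Prop :=
  ∃ (γ : ℝ → Plane) (δ : ℝ), IsBoundaryParam Ω A γ δ ∧
    deriv (deriv γ) 0 = -κ • rightNormal γ 0

/-- The class of domains under consideration: the first coordinate attains its minimum over the
closure at exactly one boundary point `A₀`, near which the boundary is smooth, and the curvature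
`κ₀` at `A₀` is positive. -/
structure IsStarkDomain (Ω : Set Plane) (A₀ : Plane) (κ₀ : ℝ) : Prop extends
    IsBoundedDomain Ω where
  mem_frontier : A₀ ∈ frontier Ω
  fst_eq : A₀ 0 = xMin Ω
  unique : ∀ A ∈ frontier Ω, A 0 = xMin Ω → A = A₀
  smooth : HasSmoothBoundaryNear Ω A₀
  curvature : HasBoundaryCurvature Ω A₀ κ₀
  curvature_pos : 0 < κ₀

/-! ### The space `H¹₀(Ω)` and the weak gradient -/

/-- The Hilbert space `L²(Ω)` of complex-valued functions. -/
abbrev L2 (Ω : Set Plane) : Type := Lp ℂ 2 (volume.restrict Ω)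

/-- The Hilbert space `L²(Ω; ℂ²)`. -/
abbrev L2Vec (Ω : Set Plane) : Type := Lp (EuclideanSpace ℂ (Fin 2)) 2 (volume.restrict Ω)

/-- Test functions: smooth with compact support contained in `Ω`. -/
structure IsTestFunction (Ω : Set Plane) (φ : Plane → ℂ) : Prop where
  contDiff : ContDiff ℝ ∞ φ
  hasCompactSupport : HasCompactSupport φ
  tsupport_subset : tsupport φ ⊆ Ω

/-- The classical gradient `(∂ₓφ, ∂ᵧφ)`. -/
def classicalGradient (φ : Plane → ℂ) (p : Plane) : EuclideanSpace ℂ (Fin 2) :=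
  WithLp.toLp 2 fun i => fderiv ℝ φ p (EuclideanSpace.single i 1)

lemma IsTestFunction.add {Ω : Set Plane} {φ χ : Plane → ℂ} (hφ : IsTestFunction Ω φ)
    (hχ : IsTestFunction Ω χ) : IsTestFunction Ω (φ + χ) where
  contDiff := hφ.contDiff.add hχ.contDiff
  hasCompactSupport := hφ.hasCompactSupport.add hχ.hasCompactSupport
  tsupport_subset := (tsupport_add φ χ).trans
    (union_subset hφ.tsupport_subset hχ.tsupport_subset)

lemma IsTestFunction.zero (Ω : Set Plane) : IsTestFunction Ω 0 where
  contDiff := contDiff_const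
  hasCompactSupport := HasCompactSupport.zero
  tsupport_subset := by simp [tsupport]

lemma IsTestFunction.const_smul {Ω : Set Plane} {φ : Plane → ℂ} (hφ : IsTestFunction Ω φ)
    (c : ℂ) : IsTestFunction Ω (c • φ) where
  contDiff := hφ.contDiff.const_smul c
  hasCompactSupport := hφ.hasCompactSupport.smul_left (f := fun _ => c)
  tsupport_subset := (tsupport_smul_subset_right (fun _ => c) φ).trans hφ.tsupport_subset

lemma IsTestFunction.differentiable {Ω : Set Plane} {φ : Plane → ℂ}
    (hφ : IsTestFunction Ω φ) : Differentiable ℝ φ :=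
  hφ.contDiff.differentiable (by simp)

/-- The pairs `(φ, ∇φ)` in `L²(Ω) × L²(Ω; ℂ²)` with `φ` a test function. -/
def testGraph (Ω : Set Plane) : Submodule ℂ (L2 Ω × L2Vec Ω) where
  carrier := {w | ∃ φ : Plane → ℂ, IsTestFunction Ω φ ∧
    w.1 =ᵐ[volume.restrict Ω] φ ∧ w.2 =ᵐ[volume.restrict Ω] classicalGradient φ}
  zero_mem' := by
    refine ⟨0, IsTestFunction.zero Ω, Lp.coeFn_zero _ _ _, ?_⟩
    filter_upwards [Lp.coeFn_zero (EuclideanSpace ℂ (Fin 2)) 2 (volume.restrict Ω)] with p hp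
    have h0 : classicalGradient 0 p = 0 := by
      ext i; simp [classicalGradient]
    rw [h0]; exact hp
  add_mem' := by
    rintro ⟨u, g⟩ ⟨u', g'⟩ ⟨φ, hφ, hu, hg⟩ ⟨χ, hχ, hu', hg'⟩
    refine ⟨φ + χ, hφ.add hχ, (Lp.coeFn_add u u').trans (hu.add hu'), ?_⟩
    filter_upwards [Lp.coeFn_add g g', hg, hg'] with p h1 h2 h3
    simp only [Prod.snd_add, h1, Pi.add_apply] at *
    rw [h2, h3]
    ext i
    simp [classicalGradient, fderiv_add (hφ.differentiable p) (hχ.differentiable p)]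
  smul_mem' := by
    rintro c ⟨u, g⟩ ⟨φ, hφ, hu, hg⟩
    refine ⟨c • φ, hφ.const_smul c, (Lp.coeFn_smul c u).trans (hu.const_smul c), ?_⟩
    filter_upwards [Lp.coeFn_smul c g, hg] with p h1 h2
    simp only [Prod.smul_snd, h1, Pi.smul_apply] at *
    rw [h2]
    ext i
    simp [classicalGradient, fderiv_const_smul (hφ.differentiable p) c]

/-- The closure of the pairs `(φ, ∇φ)`, `φ` a test function, in `L²(Ω) × L²(Ω; ℂ²)`, which carries
the topology of the `H¹` norm. -/
def sobolevGraph (Ω : Set Plane) : Submodule ℂ (L2 Ω × L2Vec Ω) :=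
  (testGraph Ω).topologicalClosure

/-- The weak gradient, with domain `H¹₀(Ω)`: the operator whose graph is the `H¹`-closure of the
classical gradient on test functions. -/
def weakGradient (Ω : Set Plane) : L2 Ω →ₗ.[ℂ] L2Vec Ω := (sobolevGraph Ω).toLinearPMap

/-- The Sobolev space `H¹₀(Ω)`: the closure of the test functions in the `H¹` norm. -/
abbrev H10 (Ω : Set Plane) : Submodule ℂ (L2 Ω) := (weakGradient Ω).domain

/-! ### The Dirichlet realization of `-h²Δ + x` -/

/-- The sesquilinear form `h² ∫ ∇u · conj ∇v + ∫ x u conj v` on `H¹₀(Ω)`, linear in `u` and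
antilinear in `v`; its value at `u = v = φ` is `h² ∫ |∇φ|² + ∫ x |φ|²`. -/
def starkForm (Ω : Set Plane) (h : ℝ) (v u : H10 Ω) : ℂ :=
  (h : ℂ) ^ 2 * inner ℂ (weakGradient Ω v) (weakGradient Ω u) +
    ∫ p in Ω, ((p 0 : ℝ) : ℂ) * inner ℂ ((v : L2 Ω) p) ((u : L2 Ω) p)

lemma integrable_potential {Ω : Set Plane} (hΩ : IsBoundedDomain Ω) (v u : L2 Ω) :
    Integrable (fun p : Plane => ((p 0 : ℝ) : ℂ) * inner ℂ (v p) (u p)) (volume.restrict Ω) := by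
  obtain ⟨R, hR⟩ := hΩ.isBounded.exists_norm_le
  refine (L2.integrable_inner v u).bdd_mul (c := R)
    (Continuous.aestronglyMeasurable (by fun_prop)) ?_
  filter_upwards [ae_restrict_mem hΩ.isOpen.measurableSet] with p hp
  simpa using (PiLp.norm_apply_le p 0).trans (hR p hp)

lemma starkForm_add {Ω : Set Plane} (hΩ : IsBoundedDomain Ω) (h : ℝ) (v u u' : H10 Ω) :
    starkForm Ω h v (u + u') = starkForm Ω h v u + starkForm Ω h v u' := by
  have key : ∫ p in Ω, ((p 0 : ℝ) : ℂ) * inner ℂ ((v : L2 Ω) p) (((u + u' : H10 Ω) : L2 Ω) p) =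
      (∫ p in Ω, ((p 0 : ℝ) : ℂ) * inner ℂ ((v : L2 Ω) p) ((u : L2 Ω) p)) +
      ∫ p in Ω, ((p 0 : ℝ) : ℂ) * inner ℂ ((v : L2 Ω) p) ((u' : L2 Ω) p) := by
    rw [← integral_add (integrable_potential hΩ v u) (integrable_potential hΩ v u')]
    refine integral_congr_ae ?_
    filter_upwards [Lp.coeFn_add (u : L2 Ω) (u' : L2 Ω)] with p hp
    rw [Submodule.coe_add, hp, Pi.add_apply, inner_add_right, mul_add]
  unfold starkForm
  rw [key, (weakGradient Ω).map_add, inner_add_right]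
  ring

lemma starkForm_smul {Ω : Set Plane} (h : ℝ) (c : ℂ) (v u : H10 Ω) :
    starkForm Ω h v (c • u) = c * starkForm Ω h v u := by
  have key : ∫ p in Ω, ((p 0 : ℝ) : ℂ) * inner ℂ ((v : L2 Ω) p) (((c • u : H10 Ω) : L2 Ω) p) =
      c * ∫ p in Ω, ((p 0 : ℝ) : ℂ) * inner ℂ ((v : L2 Ω) p) ((u : L2 Ω) p) := by
    rw [← integral_const_mul]
    refine integral_congr_ae ?_
    filter_upwards [Lp.coeFn_smul c (u : L2 Ω)] with p hp
    rw [Submodule.coe_smul, hp, Pi.smul_apply, inner_smul_right]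
    ring
  unfold starkForm
  rw [key, (weakGradient Ω).map_smul, inner_smul_right]
  ring

lemma starkForm_zero {Ω : Set Plane} (h : ℝ) (v : H10 Ω) : starkForm Ω h v 0 = 0 := by
  simpa using starkForm_smul h 0 v 0

/-- The graph of the operator associated with the form: the pairs `(u, f)` with `u ∈ H¹₀(Ω)`,
`f ∈ L²(Ω)` and `starkForm Ω h v u = ⟪v, f⟫` for all `v ∈ H¹₀(Ω)`. -/
def starkGraph {Ω : Set Plane} (hΩ : IsBoundedDomain Ω) (h : ℝ) :
    Submodule ℂ (L2 Ω × L2 Ω) where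
  carrier := {w | ∃ hu : w.1 ∈ H10 Ω, ∀ v : H10 Ω,
    starkForm Ω h v ⟨w.1, hu⟩ = inner ℂ (v : L2 Ω) w.2}
  zero_mem' := ⟨Submodule.zero_mem _, fun v => by
    rw [Prod.snd_zero, inner_zero_right]; exact starkForm_zero h v⟩
  add_mem' := by
    rintro ⟨u, f⟩ ⟨u', f'⟩ ⟨hu, hf⟩ ⟨hu', hf'⟩
    refine ⟨Submodule.add_mem _ hu hu', fun v => ?_⟩
    rw [Prod.snd_add, inner_add_right, ← hf v, ← hf' v]
    exact starkForm_add hΩ h v ⟨u, hu⟩ ⟨u', hu'⟩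
  smul_mem' := by
    rintro c ⟨u, f⟩ ⟨hu, hf⟩
    refine ⟨Submodule.smul_mem _ c hu, fun v => ?_⟩
    rw [Prod.smul_snd, inner_smul_right, ← hf v]
    exact starkForm_smul h c v ⟨u, hu⟩

/-- The Dirichlet realization in `L²(Ω)` of the Stark Hamiltonian `-h²(∂ₓ² + ∂ᵧ²) + x`, that is,
the self-adjoint operator associated with the quadratic form `h² ∫ |∇φ|² + ∫ x |φ|²` on
`H¹₀(Ω)`. -/
def starkOperator {Ω : Set Plane} (hΩ : IsBoundedDomain Ω) (h : ℝ) : L2 Ω →ₗ.[ℂ] L2 Ω :=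
  (starkGraph hΩ h).toLinearPMap

/-- `ψ` is an eigenfunction of the operator `T`, with eigenvalue `μ`. -/
def IsEigenfunction {Ω : Set Plane} (T : L2 Ω →ₗ.[ℂ] L2 Ω) (μ : ℂ) (ψ : L2 Ω) : Prop :=
  ψ ≠ 0 ∧ ∃ hψ : ψ ∈ T.domain, T ⟨ψ, hψ⟩ = μ • ψ

/-! ### The two graphs above are graphs of operators -/

lemma IsTestFunction.memLp {Ω : Set Plane} {φ : Plane → ℂ} (hφ : IsTestFunction Ω φ) :
    MemLp φ 2 (volume.restrict Ω) :=
  (hφ.contDiff.continuous.memLp_of_hasCompactSupport hφ.hasCompactSupport).restrict Ω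

lemma IsTestFunction.continuous_deriv {Ω : Set Plane} {φ : Plane → ℂ}
    (hφ : IsTestFunction Ω φ) (v : Plane) : Continuous fun p => fderiv ℝ φ p v :=
  (hφ.contDiff.continuous_fderiv (by simp)).clm_apply continuous_const

lemma IsTestFunction.memLp_gradient {Ω : Set Plane} {φ : Plane → ℂ}
    (hφ : IsTestFunction Ω φ) : MemLp (classicalGradient φ) 2 (volume.restrict Ω) := by
  have hc : Continuous (classicalGradient φ) :=
    (PiLp.continuous_toLp 2 _).comp (continuous_pi fun i => hφ.continuous_deriv _)
  refine (hc.memLp_of_hasCompactSupport ?_).restrict Ω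
  refine (hφ.hasCompactSupport.fderiv (𝕜 := ℝ)).mono' ?_
  refine (Function.support_subset_iff'.2 fun p hp => ?_).trans (subset_tsupport _)
  have h0 : fderiv ℝ φ p = 0 := by simpa using hp
  ext i
  simp [classicalGradient, h0]

lemma IsTestFunction.mem_testGraph {Ω : Set Plane} {φ : Plane → ℂ} (hφ : IsTestFunction Ω φ) :
    (hφ.memLp.toLp φ, hφ.memLp_gradient.toLp (classicalGradient φ)) ∈ testGraph Ω :=
  ⟨φ, hφ, hφ.memLp.coeFn_toLp, hφ.memLp_gradient.coeFn_toLp⟩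

lemma isTestFunction_ofReal {Ω : Set Plane} {θ : Plane → ℝ} (h1 : ContDiff ℝ ∞ θ)
    (h2 : HasCompactSupport θ) (h3 : tsupport θ ⊆ Ω) :
    IsTestFunction Ω fun p => (θ p : ℂ) where
  contDiff := Complex.ofRealCLM.contDiff.comp h1
  hasCompactSupport := h2.comp_left (g := fun t : ℝ => (t : ℂ)) (by simp)
  tsupport_subset :=
    (closure_mono (Function.support_comp_subset (g := fun t : ℝ => (t : ℂ)) (by simp) θ)).trans h3

lemma fderiv_ofReal {θ : Plane → ℝ} (h1 : ContDiff ℝ ∞ θ) (p v : Plane) :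
    fderiv ℝ (fun p => (θ p : ℂ)) p v = ((fderiv ℝ θ p v : ℝ) : ℂ) := by
  have := (Complex.ofRealCLM.hasFDerivAt (x := θ p)).comp p
    ((h1.differentiable (by simp)) p).hasFDerivAt
  have h2 : fderiv ℝ (fun p => (θ p : ℂ)) p = Complex.ofRealCLM.comp (fderiv ℝ θ p) := this.fderiv
  rw [h2]; rfl

lemma sobolevGraph_integral {Ω : Set Plane} {θ : Plane → ℝ} (h1 : ContDiff ℝ ∞ θ)
    (h2 : HasCompactSupport θ) (h3 : tsupport θ ⊆ Ω) (i : Fin 2) {g : L2Vec Ω}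
    (hw : ((0 : L2 Ω), g) ∈ sobolevGraph Ω) : ∫ p in Ω, θ p • g p i = 0 := by
  have hΘ := isTestFunction_ofReal h1 h2 h3
  have hTm : MemLp (fun p => EuclideanSpace.single i (θ p : ℂ)) 2 (volume.restrict Ω) := by
    refine hΘ.memLp.of_le ?_ (ae_of_all _ fun p => by simp)
    have : Continuous fun p => EuclideanSpace.single i (θ p : ℂ) := by
      refine (PiLp.continuous_toLp 2 _).comp (continuous_pi fun j => ?_)
      by_cases hj : j = i
      · subst hj; simpa using hΘ.contDiff.continuous
      · simpa [hj] using continuous_const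
    exact this.aestronglyMeasurable
  have hSm : MemLp (fun p => fderiv ℝ (fun p => (θ p : ℂ)) p (EuclideanSpace.single i 1)) 2
      (volume.restrict Ω) :=
    ((hΘ.continuous_deriv _).memLp_of_hasCompactSupport
      (hΘ.hasCompactSupport.fderiv_apply (𝕜 := ℝ) (EuclideanSpace.single i 1))).restrict Ω
  let F : L2 Ω × L2Vec Ω → ℂ := fun w => inner ℂ (hTm.toLp _) w.2 + inner ℂ (hSm.toLp _) w.1
  have hF : Continuous F := by fun_prop
  have hsub : ∀ w ∈ testGraph Ω, F w = 0 := by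
    rintro ⟨u, k⟩ ⟨φ, hφ, hu, hk⟩
    have e1 : inner ℂ (hTm.toLp _) k =
        ∫ p, (θ p : ℂ) * fderiv ℝ φ p (EuclideanSpace.single i 1) := by
      rw [L2.inner_def, ← setIntegral_eq_integral_of_forall_compl_eq_zero (s := Ω)
        (f := fun p => (θ p : ℂ) * fderiv ℝ φ p (EuclideanSpace.single i 1))]
      · refine integral_congr_ae ?_
        filter_upwards [hTm.coeFn_toLp, hk] with p hp hp'
        replace hp' : k p = classicalGradient φ p := hp'
        rw [hp, hp', EuclideanSpace.inner_single_left]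
        simp [classicalGradient]
      · intro p hp
        have : θ p = 0 := image_eq_zero_of_notMem_tsupport fun h => hp (h3 h)
        simp [this]
    have e2 : inner ℂ (hSm.toLp _) u =
        ∫ p, fderiv ℝ (fun p => (θ p : ℂ)) p (EuclideanSpace.single i 1) * φ p := by
      rw [L2.inner_def, ← setIntegral_eq_integral_of_forall_compl_eq_zero (s := Ω)
        (f := fun p => fderiv ℝ (fun p => (θ p : ℂ)) p (EuclideanSpace.single i 1) * φ p)]
      · refine integral_congr_ae ?_
        filter_upwards [hSm.coeFn_toLp, hu] with p hp hp'
        replace hp' : u p = φ p := hp'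
        rw [hp, hp', fderiv_ofReal h1]
        simp [mul_comm]
      · intro p hp
        have : φ p = 0 := image_eq_zero_of_notMem_tsupport fun h => hp (hφ.tsupport_subset h)
        simp [this]
    have hc := hΘ.contDiff.continuous
    have hs := hΘ.hasCompactSupport
    have e3 := integral_mul_fderiv_eq_neg_fderiv_mul_of_integrable
      (μ := (volume : Measure Plane)) (f := fun p => (θ p : ℂ)) (g := φ)
      (v := EuclideanSpace.single i 1)
      (((hΘ.continuous_deriv _).mul hφ.contDiff.continuous).integrable_of_hasCompactSupport
        hφ.hasCompactSupport.mul_left)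
      ((hc.mul (hφ.continuous_deriv _)).integrable_of_hasCompactSupport hs.mul_right)
      ((hc.mul hφ.contDiff.continuous).integrable_of_hasCompactSupport hs.mul_right)
      (fun p _ => hΘ.differentiable p) (fun p _ => hφ.differentiable p)
    change inner ℂ (hTm.toLp _) k + inner ℂ (hSm.toLp _) u = 0
    rw [e1, e2, e3]
    ring
  have hF0 : F ((0 : L2 Ω), g) = 0 :=
    closure_minimal (t := {w | F w = 0}) hsub (isClosed_eq hF continuous_const) hw
  have hF1 : inner ℂ (hTm.toLp _) g = 0 := by simpa [F] using hF0
  rw [L2.inner_def] at hF1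
  rw [← hF1]
  refine integral_congr_ae ?_
  filter_upwards [hTm.coeFn_toLp] with p hp
  rw [hp, EuclideanSpace.inner_single_left]
  simp

/-- The weak gradient is well defined. -/
lemma sobolevGraph_single_valued {Ω : Set Plane} (hΩ : IsOpen Ω) (w : L2 Ω × L2Vec Ω)
    (hw : w ∈ sobolevGraph Ω) (hw0 : w.1 = 0) : w.2 = 0 := by
  obtain ⟨u, g⟩ := w
  obtain rfl : u = 0 := hw0
  have hi : ∀ i : Fin 2, ∀ᵐ p ∂(volume.restrict Ω), g p i = 0 := by
    intro i
    have hm : MemLp (fun p => g p i) 2 (volume.restrict Ω) :=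
      (Lp.memLp g).of_le
        ((EuclideanSpace.proj i : EuclideanSpace ℂ (Fin 2) →L[ℂ] ℂ).continuous
          |>.comp_aestronglyMeasurable (Lp.aestronglyMeasurable g))
        (ae_of_all _ fun p => PiLp.norm_apply_le (g p) i)
    have hz := hΩ.ae_eq_zero_of_integral_contDiff_smul_eq_zero (μ := volume.restrict Ω)
      ((hm.locallyIntegrable (by norm_num)).locallyIntegrableOn Ω)
      (fun θ h1 h2 h3 => sobolevGraph_integral h1 h2 h3 i hw)
    filter_upwards [hz, ae_restrict_mem hΩ.measurableSet] with p hp hp'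
    exact hp hp'
  refine Lp.ext ?_
  filter_upwards [hi 0, hi 1, Lp.coeFn_zero (EuclideanSpace ℂ (Fin 2)) 2 (volume.restrict Ω)]
    with p h0 h1 hz
  refine Eq.trans ?_ hz.symm
  ext i
  fin_cases i
  · exact h0
  · exact h1

lemma weakGradient_graph {Ω : Set Plane} (hΩ : IsOpen Ω) :
    (weakGradient Ω).graph = sobolevGraph Ω :=
  Submodule.toLinearPMap_graph_eq _ (sobolevGraph_single_valued hΩ)

lemma IsTestFunction.mem_H10 {Ω : Set Plane} {φ : Plane → ℂ} (hφ : IsTestFunction Ω φ) :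
    hφ.memLp.toLp φ ∈ H10 Ω :=
  ⟨_, (testGraph Ω).le_topologicalClosure hφ.mem_testGraph, rfl⟩

/-- The Stark operator is well defined. -/
lemma starkGraph_single_valued {Ω : Set Plane} (hΩ : IsBoundedDomain Ω) (h : ℝ)
    (w : L2 Ω × L2 Ω) (hw : w ∈ starkGraph hΩ h) (hw0 : w.1 = 0) : w.2 = 0 := by
  obtain ⟨u, f⟩ := w
  obtain rfl : u = 0 := hw0
  obtain ⟨hu, hf⟩ := hw
  have hz := hΩ.isOpen.ae_eq_zero_of_integral_contDiff_smul_eq_zero (μ := volume.restrict Ω)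
    (f := f) (((Lp.memLp f).locallyIntegrable (by norm_num)).locallyIntegrableOn Ω)
    (fun θ h1 h2 h3 => by
      have hΘ := isTestFunction_ofReal h1 h2 h3
      have h0 := hf ⟨_, hΘ.mem_H10⟩
      rw [show (⟨((0 : L2 Ω), f).1, hu⟩ : H10 Ω) = 0 from rfl, starkForm_zero, L2.inner_def] at h0
      rw [h0]
      refine integral_congr_ae ?_
      filter_upwards [hΘ.memLp.coeFn_toLp] with p hp
      rw [hp]
      simp [mul_comm])
  refine Lp.ext ?_
  filter_upwards [hz, ae_restrict_mem hΩ.isOpen.measurableSet,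
    Lp.coeFn_zero ℂ 2 (volume.restrict Ω)] with p hp hp' h0
  exact (hp hp').trans h0.symm

lemma starkOperator_graph {Ω : Set Plane} (hΩ : IsBoundedDomain Ω) (h : ℝ) :
    (starkOperator hΩ h).graph = starkGraph hΩ h :=
  Submodule.toLinearPMap_graph_eq _ (starkGraph_single_valued hΩ h)

lemma starkOperator_domain_le {Ω : Set Plane} (hΩ : IsBoundedDomain Ω) (h : ℝ) :
    (starkOperator hΩ h).domain ≤ H10 Ω := by
  rintro u ⟨w, ⟨hu, -⟩, rfl⟩
  exact hu

end Stark

end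

/-! Agmon estimate. Write t = x - x_min, m = M h^{2/3} and W = exp(2t^{3/2}/(3h)), and test the
eigenvalue equation against Wψ. Since h ∂ₓW = √t W, Young's inequality bounds the cross term by
(h²/2) W|∇ψ|² + (t/2) W|ψ|². As μ ≤ x_min + m, what remains is (h²/2) W|∇ψ|² + (t/2 - m) W|ψ|², with
nonpositive integral. Where t ≥ 4m, t/2 - m ≥ m. Where t ≤ 4m, the quantity t^{3/2}/h is at most
(4M)^{3/2} whatever h is, so W ≤ K = exp((2/3)(4M)^{3/2}) and the defect is at most 2mK|ψ|². This is
`agmon_pointwise`; integrated in `agmon_estimate`, it gives both bounds.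

That Wψ is admissible rests on `exists_mem_sobolevGraph_mul`. The weight is smooth where t > 0,
hence on Ω by `xMin_lt`, and W with its gradient extends continuously to the closure. As Ω is
bounded, W needs no truncation. -/

namespace Stark

/-! ### Multiplication operators and the Leibniz rule on H¹₀(Ω) -/

/-- A continuous function is bounded on a bounded subset of the plane. -/
lemma exists_norm_le_of_isBounded {E : Type*} [NormedAddCommGroup E] {Ω : Set Plane}
    (hΩ : Bornology.IsBounded Ω) {f : Plane → E} (hf : Continuous f) :
    ∃ C : ℝ, ∀ p ∈ Ω, ‖f p‖ ≤ C := by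
  obtain ⟨C, hC⟩ := hΩ.isCompact_closure.exists_bound_of_continuousOn hf.continuousOn
  exact ⟨C, fun p hp => hC p (subset_closure hp)⟩

/-- Pointwise application of a continuous field of operators is bounded on `L²(Ω)` when `Ω` is
bounded. -/
lemma exists_clm_coeFn_eq {E F : Type*} [NormedAddCommGroup E] [NormedSpace ℂ E]
    [NormedAddCommGroup F] [NormedSpace ℂ F] {Ω : Set Plane} (hΩ : IsBoundedDomain Ω)
    {k : Plane → E →L[ℂ] F} (hk : Continuous k) :
    ∃ T : Lp E 2 (volume.restrict Ω) →L[ℂ] Lp F 2 (volume.restrict Ω),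
      ∀ u, T u =ᵐ[volume.restrict Ω] fun p => k p (u p) := by
  obtain ⟨C, hC⟩ := exists_norm_le_of_isBounded hΩ.isBounded hk
  have hb : MemLp k ⊤ (volume.restrict Ω) := by
    refine memLp_top_of_bound hk.aestronglyMeasurable C ?_
    filter_upwards [ae_restrict_mem hΩ.isOpen.measurableSet] with p hp using hC p hp
  -- Hölder with exponents ∞, 2, 2, the pairing being evaluation of an operator at a vector.
  refine ⟨(ContinuousLinearMap.id ℂ (E →L[ℂ] F)).holderL (volume.restrict Ω) ⊤ 2 2
    (hb.toLp k), fun u => ?_⟩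
  rw [ContinuousLinearMap.holderL_apply_apply]
  refine (ContinuousLinearMap.coeFn_holder _ _ _).trans ?_
  filter_upwards [hb.coeFn_toLp] with p hp
  rw [hp]; rfl

/-- A test function times a function that is smooth on `Ω` is a test function. -/
lemma IsTestFunction.mul_left {Ω : Set Plane} {φ w : Plane → ℂ} (hφ : IsTestFunction Ω φ)
    (hw : ∀ p ∈ Ω, ContDiffAt ℝ ∞ w p) : IsTestFunction Ω (fun p => w p * φ p) where
  contDiff := by
    refine contDiff_iff_contDiffAt.2 fun p => ?_
    -- `w` may be singular outside Ω, but the product vanishes near every point off the support of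
    -- φ.
    by_cases hp : p ∈ tsupport φ
    · exact (hw p (hφ.tsupport_subset hp)).mul hφ.contDiff.contDiffAt
    · refine contDiffAt_const (c := (0 : ℂ)) |>.congr_of_eventuallyEq ?_
      filter_upwards [notMem_tsupport_iff_eventuallyEq.1 hp] with q hq
      simp [hq]
  hasCompactSupport := hφ.hasCompactSupport.mul_left
  tsupport_subset := (tsupport_mul_subset_right).trans hφ.tsupport_subset

/-- `H¹₀(Ω)` is stable under multiplication by a function `w` smooth on `Ω` that is continuous,
together with its gradient `k`, up to the boundary; the gradient of the product is given by the
Leibniz rule. -/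
lemma exists_mem_sobolevGraph_mul {Ω : Set Plane} (hΩ : IsBoundedDomain Ω) {w : Plane → ℂ}
    {k : Plane → EuclideanSpace ℂ (Fin 2)} (hw : Continuous w) (hk : Continuous k)
    (hw' : ∀ p ∈ Ω, ContDiffAt ℝ ∞ w p) (hwk : ∀ p ∈ Ω, classicalGradient w p = k p)
    {z : L2 Ω × L2Vec Ω} (hz : z ∈ sobolevGraph Ω) :
    ∃ z' ∈ sobolevGraph Ω, z'.1 =ᵐ[volume.restrict Ω] (fun p => w p * z.1 p) ∧
      z'.2 =ᵐ[volume.restrict Ω] fun p => w p • z.2 p + z.1 p • k p := by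
  have c1 : Continuous fun p => w p • ContinuousLinearMap.id ℂ ℂ := by fun_prop
  have c2 : Continuous fun p => w p • ContinuousLinearMap.id ℂ (EuclideanSpace ℂ (Fin 2)) := by
    fun_prop
  have c3 : Continuous fun p => (ContinuousLinearMap.toSpanSingleton ℂ (k p)) :=
    (ContinuousLinearMap.toSpanSingletonLIE ℂ (EuclideanSpace ℂ (Fin 2))).continuous.comp hk
  obtain ⟨T1, h1⟩ := exists_clm_coeFn_eq hΩ c1
  obtain ⟨T2, h2⟩ := exists_clm_coeFn_eq hΩ c2
  obtain ⟨T3, h3⟩ := exists_clm_coeFn_eq hΩ c3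
  -- The Leibniz rule as a continuous map on pairs (function, gradient): it preserves the test
  -- graph, hence its closure.
  let T : L2 Ω × L2Vec Ω → L2 Ω × L2Vec Ω := fun z => (T1 z.1, T2 z.2 + T3 z.1)
  have hT : Continuous T := by fun_prop
  have hmaps : MapsTo T (testGraph Ω) (testGraph Ω) := by
    rintro ⟨u, g⟩ ⟨φ, hφ, hu, hg⟩
    have hu' : u =ᵐ[volume.restrict Ω] φ := hu
    have hg' : g =ᵐ[volume.restrict Ω] classicalGradient φ := hg
    refine ⟨_, hφ.mul_left hw', ?_, ?_⟩
    · filter_upwards [h1 u, hu'] with p hp hp'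
      change T1 u p = _
      rw [hp, hp']; simp
    · filter_upwards [Lp.coeFn_add (T2 g) (T3 u), h2 g, h3 u, hu', hg',
        ae_restrict_mem hΩ.isOpen.measurableSet] with p hp hp2 hp3 hpu hpg hpΩ
      change (T2 g + T3 u : L2Vec Ω) p = _
      rw [hp, Pi.add_apply, hp2, hp3, hpu, hpg, ← hwk p hpΩ]
      ext i
      have := fderiv_fun_mul ((hw' p hpΩ).differentiableAt (by simp)) (hφ.differentiable p)
      simp [classicalGradient, this]
  refine ⟨T z, hmaps.closure hT hz, ?_, ?_⟩
  · filter_upwards [h1 z.1] with p hp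
    change T1 z.1 p = _
    rw [hp]; simp
  · filter_upwards [Lp.coeFn_add (T2 z.2) (T3 z.1), h2 z.2, h3 z.1] with p hp hp2 hp3
    change (T2 z.2 + T3 z.1 : L2Vec Ω) p = _
    rw [hp, Pi.add_apply, hp2, hp3]; simp

/-! ### The Agmon weight -/

/-- The infimum of the first coordinate is not attained on the open set `Ω`. -/
lemma xMin_lt {Ω : Set Plane} (hΩ : IsBoundedDomain Ω) {p : Plane} (hp : p ∈ Ω) :
    xMin Ω < p 0 := by
  have hbdd : BddBelow ((fun p : Plane => p 0) '' Ω) := by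
    obtain ⟨C, hC⟩ := exists_norm_le_of_isBounded hΩ.isBounded
      (f := fun p : Plane => p 0) (by fun_prop)
    refine ⟨-C, ?_⟩
    rintro _ ⟨q, hq, rfl⟩
    exact (abs_le.1 (hC q hq)).1
  -- Openness allows a small move to the left inside Ω, which makes the inequality strict.
  have hc : Continuous fun s : ℝ => p - s • EuclideanSpace.single (0 : Fin 2) (1 : ℝ) := by
    fun_prop
  have hev : ∀ᶠ s in 𝓝[>] (0 : ℝ), p - s • EuclideanSpace.single (0 : Fin 2) (1 : ℝ) ∈ Ω :=
    (hc.tendsto 0).mono_left nhdsWithin_le_nhds (hΩ.isOpen.mem_nhds (by simpa using hp))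
  obtain ⟨s, hs, hs0⟩ := (hev.and self_mem_nhdsWithin).exists
  have h1 := csInf_le hbdd (mem_image_of_mem (fun p : Plane => p 0) hs)
  have hs0' : 0 < s := hs0
  simp only [PiLp.sub_apply, PiLp.smul_apply, PiLp.single_apply, if_true,
    smul_eq_mul, mul_one] at h1
  unfold xMin
  linarith

/-- The Agmon weight `exp (2 |x - a|^{3/2} / (3h))`. -/
noncomputable def agmonWeight (a h : ℝ) (p : Plane) : ℝ :=
  Real.exp (2 / 3 * |p 0 - a| ^ (3 / 2 : ℝ) / h)

lemma continuous_agmonWeight (a h : ℝ) : Continuous (agmonWeight a h) := by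
  have h1 : Continuous fun p : Plane => |p 0 - a| := by fun_prop
  exact Real.continuous_exp.comp
    ((continuous_const.mul (h1.rpow_const fun _ => Or.inr (by norm_num))).div_const h)

lemma agmonWeight_pos (a h : ℝ) (p : Plane) : 0 < agmonWeight a h p := Real.exp_pos _

lemma contDiffAt_agmonWeight (a h : ℝ) {p : Plane} (hp : a < p 0) :
    ContDiffAt ℝ ∞ (agmonWeight a h) p := by
  have h0 : p 0 - a ≠ 0 := by linarith
  have h1 : ContDiffAt ℝ ∞ (fun q : Plane => q 0 - a) p := by fun_prop
  have h2 : ContDiffAt ℝ ∞ (fun q : Plane => |q 0 - a|) p := h1.abs h0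
  have h3 := h2.rpow_const_of_ne (p := 3 / 2) (abs_ne_zero.2 h0)
  exact ((contDiffAt_const.mul h3).div_const h).exp

/-- The factor 2/3 in the exponent cancels the 3/2 from differentiation, so h ∂ₓW = √t W exactly;
the square of √t is then comparable with the potential t. -/
lemma fderiv_agmonWeight (a h : ℝ) {p : Plane} (hp : a < p 0) (v : Plane) :
    fderiv ℝ (agmonWeight a h) p v = agmonWeight a h p * √(p 0 - a) / h * v 0 := by
  have h0 : 0 < p 0 - a := by linarith
  have h1 : HasFDerivAt (fun q : Plane => q 0 - a)
      (EuclideanSpace.proj 0 : Plane →L[ℝ] ℝ) p :=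
    (EuclideanSpace.proj 0 : Plane →L[ℝ] ℝ).hasFDerivAt.sub_const a
  have h2 : HasDerivAt (fun t : ℝ => Real.exp (2 / 3 * |t| ^ (3 / 2 : ℝ) / h))
      (agmonWeight a h p * √(p 0 - a) / h) (p 0 - a) := by
    have e := (((Real.hasDerivAt_rpow_const (p := 3 / 2) (Or.inl h0.ne')).const_mul
      (2 / 3)).div_const h).exp
    have e' := e.congr_of_eventuallyEq
      (f₁ := fun t : ℝ => Real.exp (2 / 3 * |t| ^ (3 / 2 : ℝ) / h)) (by
        filter_upwards [lt_mem_nhds h0] with t ht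
        rw [abs_of_pos ht])
    refine e'.congr_deriv ?_
    rw [agmonWeight, abs_of_pos h0, Real.sqrt_eq_rpow]
    norm_num
    ring
  have h3 := (h2.comp_hasFDerivAt p h1).fderiv
  change fderiv ℝ (agmonWeight a h) p = _ at h3
  rw [h3]
  simp

/-- The exponent depends only on t/h^{2/3}, so the bound is uniform in h. The threshold 4M h^{2/3}
is where t/2 - m reaches m. -/
lemma agmonWeight_le {a h M : ℝ} (hh : 0 < h) (hM : 0 ≤ M) {p : Plane}
    (hp : |p 0 - a| ≤ 4 * (M * h ^ (2 / 3 : ℝ))) :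
    agmonWeight a h p ≤ Real.exp (2 / 3 * (4 * M) ^ (3 / 2 : ℝ)) := by
  have h1 : |p 0 - a| ^ (3 / 2 : ℝ) ≤ (4 * M) ^ (3 / 2 : ℝ) * h := by
    calc |p 0 - a| ^ (3 / 2 : ℝ) ≤ (4 * (M * h ^ (2 / 3 : ℝ))) ^ (3 / 2 : ℝ) := by gcongr
      _ = (4 * M) ^ (3 / 2 : ℝ) * h := by
        rw [← mul_assoc, Real.mul_rpow (by positivity) (by positivity), ← Real.rpow_mul hh.le]
        norm_num
  refine Real.exp_le_exp.2 ?_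
  rw [div_le_iff₀ hh]
  linarith

/-! ### The pointwise inequality -/

/-- Pointwise form of the Agmon estimate: the exponential weight costs at most half of the
potential. -/
lemma agmon_pointwise {h t m K W s : ℝ} {z : ℂ} {g : EuclideanSpace ℂ (Fin 2)} (hh : 0 < h)
    (ht : 0 < t) (hm : 0 ≤ m) (hK : 0 ≤ K) (hW : 0 < W) (hWK : t ≤ 4 * m → W ≤ K)
    (hs : t - m ≤ s) :
    h ^ 2 / 2 * (W * ‖g‖ ^ 2) + m * (W * ‖z‖ ^ 2) - 2 * m * K * ‖z‖ ^ 2 ≤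
      h ^ 2 * (W * ‖g‖ ^ 2 + W * √t / h * (star z * g 0).re) + s * (W * ‖z‖ ^ 2) := by
  have h1 : -(‖z‖ * ‖g‖) ≤ (star z * g 0).re := by
    have e1 := (abs_le.1 (Complex.abs_re_le_norm (star z * g 0))).1
    have e2 : ‖star z * g 0‖ ≤ ‖z‖ * ‖g‖ := by
      rw [norm_mul, norm_star]
      exact mul_le_mul_of_nonneg_left (PiLp.norm_apply_le g 0) (norm_nonneg _)
    linarith
  have h2 : h ^ 2 * (W * √t / h * (star z * g 0).re) = W * (h * √t * (star z * g 0).re) := by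
    field_simp
  have h3 : -(h ^ 2 / 2 * ‖g‖ ^ 2 + t / 2 * ‖z‖ ^ 2) ≤ h * √t * (star z * g 0).re := by
    have e1 := mul_le_mul_of_nonneg_left h1 (by positivity : 0 ≤ h * √t)
    -- Young's inequality, balanced to use half of the kinetic term and half of t.
    have e2 := sq_nonneg (h * ‖g‖ - √t * ‖z‖)
    have e3 := Real.sq_sqrt ht.le
    have e4 : (h * ‖g‖ - √t * ‖z‖) ^ 2 =
      h ^ 2 * ‖g‖ ^ 2 - 2 * (h * √t * (‖z‖ * ‖g‖)) + √t ^ 2 * ‖z‖ ^ 2 := by ring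
    rw [e4, e3] at e2
    linarith
  have h4 := mul_le_mul_of_nonneg_left h3 hW.le
  have h5 : (t - m) * (W * ‖z‖ ^ 2) ≤ s * (W * ‖z‖ ^ 2) := by gcongr
  have h6 : m * (W * ‖z‖ ^ 2) - 2 * m * K * ‖z‖ ^ 2 ≤ (t / 2 - m) * (W * ‖z‖ ^ 2) := by
    -- Near the minimum, -mW = mW - 2mW ≥ mW - 2mK; far from it, t/2 - m ≥ m and no correction is
    -- needed.
    rcases le_total t (4 * m) with h | h
    · have e1 : 0 ≤ 2 * m * (K - W) * ‖z‖ ^ 2 := by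
        have := sub_nonneg.2 (hWK h)
        positivity
      have e2 : 0 ≤ t / 2 * (W * ‖z‖ ^ 2) := by positivity
      linarith
    · have e1 : 0 ≤ 2 * m * K * ‖z‖ ^ 2 := by positivity
      have e2 : 0 ≤ (t / 2 - 2 * m) * (W * ‖z‖ ^ 2) :=
        mul_nonneg (by linarith) (by positivity)
      linarith
  rw [mul_add, h2]
  linarith

/-! ### The weak equation and the weighted test function -/

/-- The real part of the weak eigenvalue equation, tested against `v ∈ H¹₀(Ω)`. -/
lemma integral_re_eq_zero_of_eigenfunction {Ω : Set Plane} (hΩ : IsBoundedDomain Ω) {h μ : ℝ}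
    {u : L2 Ω} (hu : IsEigenfunction (starkOperator hΩ h) (μ : ℂ) u) :
    ∃ hu' : u ∈ H10 Ω, ∀ v : H10 Ω,
      Integrable (fun p => h ^ 2 * (inner ℂ (weakGradient Ω v p)
          (weakGradient Ω ⟨u, hu'⟩ p) : ℂ).re + (p 0 - μ) * (inner ℂ ((v : L2 Ω) p) (u p) : ℂ).re)
        (volume.restrict Ω) ∧
      ∫ p in Ω, (h ^ 2 * (inner ℂ (weakGradient Ω v p) (weakGradient Ω ⟨u, hu'⟩ p) : ℂ).re +
          (p 0 - μ) * (inner ℂ ((v : L2 Ω) p) (u p) : ℂ).re) = 0 := by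
  obtain ⟨-, hd, he⟩ := hu
  have hmem := (starkOperator hΩ h).mem_graph ⟨u, hd⟩
  rw [starkOperator_graph, he] at hmem
  obtain ⟨hu', hf⟩ := hmem
  refine ⟨hu', fun v => ?_⟩
  have hf' : starkForm Ω h v ⟨u, hu'⟩ = inner ℂ (v : L2 Ω) ((μ : ℂ) • u) := hf v
  have i1 := L2.integrable_inner (𝕜 := ℂ) (weakGradient Ω v) (weakGradient Ω ⟨u, hu'⟩)
  have i2 := integrable_potential hΩ v u
  have i3 := L2.integrable_inner (𝕜 := ℂ) (v : L2 Ω) u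
  rw [starkForm, inner_smul_right, L2.inner_def, L2.inner_def] at hf'
  have hI := ((i1.const_mul ((h : ℂ) ^ 2)).add i2).sub (i3.const_mul (μ : ℂ))
  have h0 : ∫ p in Ω, ((h : ℂ) ^ 2 * inner ℂ (weakGradient Ω v p) (weakGradient Ω ⟨u, hu'⟩ p) +
      ((p 0 : ℝ) : ℂ) * inner ℂ ((v : L2 Ω) p) (u p) -
      (μ : ℂ) * inner ℂ ((v : L2 Ω) p) (u p)) = 0 := by
    refine (integral_sub' ((i1.const_mul ((h : ℂ) ^ 2)).add i2) (i3.const_mul (μ : ℂ))).trans ?_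
    rw [integral_add' (i1.const_mul ((h : ℂ) ^ 2)) i2, integral_const_mul, integral_const_mul, hf',
      sub_self]
  have hre : ∀ p : Plane, ((h : ℂ) ^ 2 *
        inner ℂ (weakGradient Ω v p) (weakGradient Ω ⟨u, hu'⟩ p) +
      ((p 0 : ℝ) : ℂ) * inner ℂ ((v : L2 Ω) p) (u p) -
      (μ : ℂ) * inner ℂ ((v : L2 Ω) p) (u p)).re =
      h ^ 2 * (inner ℂ (weakGradient Ω v p) (weakGradient Ω ⟨u, hu'⟩ p) : ℂ).re +
          (p 0 - μ) * (inner ℂ ((v : L2 Ω) p) (u p) : ℂ).re := by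
    intro p
    rw [← Complex.ofReal_pow, Complex.sub_re, Complex.add_re, Complex.re_ofReal_mul,
      Complex.re_ofReal_mul, Complex.re_ofReal_mul]
    ring
  have hI' := hI.re
  constructor
  · exact hI'.congr (ae_of_all _ hre)
  · rw [← integral_congr_ae (ae_of_all _ hre)]
    have := integral_re (𝕜 := ℂ) hI
    refine this.trans ?_
    exact (congrArg Complex.re h0)

/-- The Agmon weight times an element of `H¹₀(Ω)` is in `H¹₀(Ω)`, with the expected gradient. -/
lemma exists_agmonWeight_mul_mem {Ω : Set Plane} (hΩ : IsBoundedDomain Ω) (h : ℝ) (u : H10 Ω) :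
    ∃ v : H10 Ω,
      (v : L2 Ω) =ᵐ[volume.restrict Ω] (fun p => (agmonWeight (xMin Ω) h p : ℂ) * (u : L2 Ω) p) ∧
      weakGradient Ω v =ᵐ[volume.restrict Ω] fun p =>
        (agmonWeight (xMin Ω) h p : ℂ) • weakGradient Ω u p + (u : L2 Ω) p •
          EuclideanSpace.single 0
            ((agmonWeight (xMin Ω) h p * √(p 0 - xMin Ω) / h : ℝ) : ℂ) := by
  have hz : ((u : L2 Ω), weakGradient Ω u) ∈ sobolevGraph Ω := by
    rw [← weakGradient_graph hΩ.isOpen]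
    exact (weakGradient Ω).mem_graph u
  have hW := continuous_agmonWeight (xMin Ω) h
  -- Since `√` is zero on negative reals, this field is continuous on the whole plane; it has to
  -- agree with the gradient of the weight only on Ω.
  have hk : Continuous fun p : Plane => (EuclideanSpace.single (0 : Fin 2)
      ((agmonWeight (xMin Ω) h p * √(p 0 - xMin Ω) / h : ℝ) : ℂ)) := by
    refine (PiLp.continuous_toLp 2 _).comp (continuous_pi fun j => ?_)
    by_cases hj : j = 0
    · subst hj
      simp only [Pi.single_eq_same]
      fun_prop
    · simpa [hj] using continuous_const
  obtain ⟨z, hz', h1, h2⟩ := exists_mem_sobolevGraph_mul hΩ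
    (w := fun p => (agmonWeight (xMin Ω) h p : ℂ)) (by fun_prop) hk
    (fun p hp => Complex.ofRealCLM.contDiff.contDiffAt.comp p
      (contDiffAt_agmonWeight _ h (xMin_lt hΩ hp)))
    (fun p hp => by
      have hd := (contDiffAt_agmonWeight _ h (xMin_lt hΩ hp)).differentiableAt (by simp)
      have hf : fderiv ℝ (fun p => (agmonWeight (xMin Ω) h p : ℂ)) p =
          Complex.ofRealCLM.comp (fderiv ℝ (agmonWeight (xMin Ω) h) p) :=
        ((Complex.ofRealCLM.hasFDerivAt (x := agmonWeight (xMin Ω) h p)).comp p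
          hd.hasFDerivAt).fderiv
      ext i
      simp only [classicalGradient, hf, ContinuousLinearMap.comp_apply,
        fderiv_agmonWeight _ h (xMin_lt hΩ hp)]
      fin_cases i <;> simp) hz
  rw [← weakGradient_graph hΩ.isOpen, LinearPMap.mem_graph_iff] at hz'
  obtain ⟨v, hv1, hv2⟩ := hz'
  refine ⟨v, ?_, ?_⟩
  · rw [hv1]; exact h1
  · rw [hv2]; exact h2

/-- The weight is bounded on the bounded set Ω; the bound may depend on h, as only finiteness is
needed. -/
lemma integrable_agmonWeight_mul {E : Type*} [NormedAddCommGroup E] {Ω : Set Plane}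
    (hΩ : IsBoundedDomain Ω) (a h : ℝ) (u : Lp E 2 (volume.restrict Ω)) :
    Integrable (fun p => agmonWeight a h p * ‖u p‖ ^ 2) (volume.restrict Ω) := by
  obtain ⟨C, hC⟩ := exists_norm_le_of_isBounded hΩ.isBounded (continuous_agmonWeight a h)
  refine ((Lp.memLp u).integrable_norm_pow (by norm_num)).bdd_mul (c := C)
    (continuous_agmonWeight a h).aestronglyMeasurable ?_
  filter_upwards [ae_restrict_mem hΩ.isOpen.measurableSet] with p hp using hC p hp

lemma integral_norm_sq_eq {Ω : Set Plane} (u : L2 Ω) : ∫ p in Ω, ‖u p‖ ^ 2 = ‖u‖ ^ 2 := by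
  have h1 := L2.inner_def (𝕜 := ℂ) u u
  have h2 : ∀ p, inner ℂ (u p) (u p) = ((‖u p‖ ^ 2 : ℝ) : ℂ) := fun p => by
    rw [inner_self_eq_norm_sq_to_K]; simp
  simp_rw [h2] at h1
  rw [integral_complex_ofReal, inner_self_eq_norm_sq_to_K] at h1
  refine Complex.ofReal_injective (h1.symm.trans ?_)
  simp

/-! ### The weighted energy estimate and the conclusion -/

/-- The weighted energy estimate for the eigenfunctions. -/
lemma agmon_estimate {Ω : Set Plane} (hΩ : IsBoundedDomain Ω) {M h μ : ℝ} (hM : 0 ≤ M)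
    (hh : 0 < h) (hμ : μ ≤ xMin Ω + M * h ^ (2 / 3 : ℝ)) {ψ : L2 Ω}
    (hψ : IsEigenfunction (starkOperator hΩ h) (μ : ℂ) ψ) :
    ∃ hψ' : ψ ∈ H10 Ω,
      h ^ 2 / 2 * (∫ p in Ω, agmonWeight (xMin Ω) h p * ‖weakGradient Ω ⟨ψ, hψ'⟩ p‖ ^ 2) +
        M * h ^ (2 / 3 : ℝ) * ∫ p in Ω, agmonWeight (xMin Ω) h p * ‖ψ p‖ ^ 2 ≤
      2 * (M * h ^ (2 / 3 : ℝ)) * Real.exp (2 / 3 * (4 * M) ^ (3 / 2 : ℝ)) * ‖ψ‖ ^ 2 := by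
  obtain ⟨hψ', hz⟩ := integral_re_eq_zero_of_eigenfunction hΩ hψ
  refine ⟨hψ', ?_⟩
  obtain ⟨v, hv1, hv2⟩ := exists_agmonWeight_mul_mem hΩ h ⟨ψ, hψ'⟩
  obtain ⟨hI, h0⟩ := hz v
  have i1 := (integrable_agmonWeight_mul hΩ (xMin Ω) h (weakGradient Ω ⟨ψ, hψ'⟩)).const_mul
    (h ^ 2 / 2)
  have i2 := (integrable_agmonWeight_mul hΩ (xMin Ω) h ψ).const_mul (M * h ^ (2 / 3 : ℝ))
  have i3 := ((Lp.memLp ψ).integrable_norm_pow (p := 2) (by norm_num)).const_mul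
    (2 * (M * h ^ (2 / 3 : ℝ)) * Real.exp (2 / 3 * (4 * M) ^ (3 / 2 : ℝ)))
  -- The right-hand integrand is that of the weak equation tested against v = Wψ, so its integral is
  -- zero; `e1` and `e2` expand it into the form of `agmon_pointwise`.
  have hle := integral_mono_ae ((i1.add i2).sub i3) hI (by
    filter_upwards [hv1, hv2, ae_restrict_mem hΩ.isOpen.measurableSet] with p h1 h2 hp
    have ht := sub_pos.2 (xMin_lt hΩ hp)
    have hW := agmonWeight_pos (xMin Ω) h p
    have key := agmon_pointwise (z := ψ p) (g := weakGradient Ω ⟨ψ, hψ'⟩ p) hh ht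
      (by positivity : 0 ≤ M * h ^ (2 / 3 : ℝ)) (Real.exp_pos _).le hW
      (fun hle => agmonWeight_le hh hM (by rwa [abs_of_pos ht]))
      (by linarith : p 0 - xMin Ω - M * h ^ (2 / 3 : ℝ) ≤ p 0 - μ)
    refine key.trans (le_of_eq ?_)
    have e1 : (inner ℂ ((v : L2 Ω) p) (ψ p) : ℂ).re =
        agmonWeight (xMin Ω) h p * ‖ψ p‖ ^ 2 := by
      rw [h1, ← smul_eq_mul, inner_smul_left, Complex.conj_ofReal, Complex.re_ofReal_mul]
      congr 1
      exact inner_self_eq_norm_sq (𝕜 := ℂ) (ψ p)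
    have e2 : (inner ℂ (weakGradient Ω v p) (weakGradient Ω ⟨ψ, hψ'⟩ p) : ℂ).re =
        agmonWeight (xMin Ω) h p * ‖weakGradient Ω ⟨ψ, hψ'⟩ p‖ ^ 2 +
          agmonWeight (xMin Ω) h p * √(p 0 - xMin Ω) / h *
            (star (ψ p) * weakGradient Ω ⟨ψ, hψ'⟩ p 0).re := by
      rw [h2, inner_add_left, inner_smul_left, inner_smul_left, Complex.conj_ofReal,
        EuclideanSpace.inner_single_left, Complex.conj_ofReal, Complex.add_re,
        Complex.re_ofReal_mul, mul_left_comm, Complex.re_ofReal_mul]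
      congr 2
      exact inner_self_eq_norm_sq (𝕜 := ℂ) (weakGradient Ω ⟨ψ, hψ'⟩ p)
    rw [e1, e2])
  rw [h0] at hle
  rw [integral_sub' (i1.add i2) i3, integral_add' i1 i2, integral_const_mul, integral_const_mul, integral_const_mul,
    integral_norm_sq_eq] at hle
  linarith

end Stark

theorem mainTheorem3 (Ω : Set Stark.Plane) (A₀ : Stark.Plane) (κ₀ : ℝ)
    (hΩ : Stark.IsStarkDomain Ω A₀ κ₀) (M : ℝ) (hM : 0 < M) :
    ∃ ε C h₀ : ℝ, 0 < ε ∧ 0 < C ∧ 0 < h₀ ∧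
      ∀ h : ℝ, 0 < h → h < h₀ →
      ∀ μ : ℝ, μ ≤ Stark.xMin Ω + M * h ^ (2 / 3 : ℝ) →
      ∀ ψ : Stark.L2 Ω,
        Stark.IsEigenfunction (Stark.starkOperator hΩ.toIsBoundedDomain h) (μ : ℂ) ψ →
        ∃ hψ : ψ ∈ Stark.H10 Ω,
          (IntegrableOn (fun p : Stark.Plane =>
              Real.exp (ε * |p 0 - Stark.xMin Ω| ^ (3 / 2 : ℝ) / h) * ‖ψ p‖ ^ 2) Ω ∧
            ∫ p in Ω, Real.exp (ε * |p 0 - Stark.xMin Ω| ^ (3 / 2 : ℝ) / h) * ‖ψ p‖ ^ 2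
              ≤ C * ‖ψ‖ ^ 2) ∧
          (IntegrableOn (fun p : Stark.Plane =>
              Real.exp (ε * |p 0 - Stark.xMin Ω| ^ (3 / 2 : ℝ) / h) *
                ‖(h : ℂ) • Stark.weakGradient Ω ⟨ψ, hψ⟩ p‖ ^ 2) Ω ∧
            ∫ p in Ω, Real.exp (ε * |p 0 - Stark.xMin Ω| ^ (3 / 2 : ℝ) / h) *
                ‖(h : ℂ) • Stark.weakGradient Ω ⟨ψ, hψ⟩ p‖ ^ 2
              ≤ C * h ^ (2 / 3 : ℝ) * ‖ψ‖ ^ 2) := by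
  set K := Real.exp (2 / 3 * (4 * M) ^ (3 / 2 : ℝ)) with hK
  have hK0 : 0 < K := Real.exp_pos _
  -- With ε = 2/3 the exponential is the Agmon weight itself. Dropping the gradient term and
  -- dividing by M h^{2/3} gives the constant 2K; dropping the other term and doubling gives 4MK
  -- h^{2/3}. The sum serves both bounds.
  refine ⟨2 / 3, 2 * K + 4 * M * K, 1, by norm_num, by positivity, one_pos,
    fun h hh _ μ hμ ψ hψ => ?_⟩
  obtain ⟨hψ', hest⟩ := Stark.agmon_estimate hΩ.toIsBoundedDomain hM.le hh hμ hψ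
  have i1 := Stark.integrable_agmonWeight_mul hΩ.toIsBoundedDomain (Stark.xMin Ω) h ψ
  have i2 := Stark.integrable_agmonWeight_mul hΩ.toIsBoundedDomain (Stark.xMin Ω) h
    (Stark.weakGradient Ω ⟨ψ, hψ'⟩)
  have hm : 0 < M * h ^ (2 / 3 : ℝ) := by positivity
  have n1 : 0 ≤ ∫ p in Ω, Stark.agmonWeight (Stark.xMin Ω) h p * ‖ψ p‖ ^ 2 :=
    integral_nonneg fun p => mul_nonneg (Real.exp_pos _).le (sq_nonneg _)
  have n2 : 0 ≤ ∫ p in Ω, Stark.agmonWeight (Stark.xMin Ω) h p *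
      ‖Stark.weakGradient Ω ⟨ψ, hψ'⟩ p‖ ^ 2 :=
    integral_nonneg fun p => mul_nonneg (Real.exp_pos _).le (sq_nonneg _)
  have hg : ∀ p, Real.exp (2 / 3 * |p 0 - Stark.xMin Ω| ^ (3 / 2 : ℝ) / h) *
      ‖(h : ℂ) • Stark.weakGradient Ω ⟨ψ, hψ'⟩ p‖ ^ 2 =
      h ^ 2 * (Stark.agmonWeight (Stark.xMin Ω) h p *
        ‖Stark.weakGradient Ω ⟨ψ, hψ'⟩ p‖ ^ 2) := fun p => by
    rw [norm_smul, Complex.norm_real, Real.norm_of_nonneg hh.le, Stark.agmonWeight]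
    ring
  refine ⟨hψ', ⟨i1, ?_⟩, ?_, ?_⟩
  · have h1 : M * h ^ (2 / 3 : ℝ) *
        (∫ p in Ω, Stark.agmonWeight (Stark.xMin Ω) h p * ‖ψ p‖ ^ 2) ≤
        M * h ^ (2 / 3 : ℝ) * (2 * K * ‖ψ‖ ^ 2) := by
      have : 0 ≤ h ^ 2 / 2 * ∫ p in Ω, Stark.agmonWeight (Stark.xMin Ω) h p *
        ‖Stark.weakGradient Ω ⟨ψ, hψ'⟩ p‖ ^ 2 := by positivity
      linarith
    have h2 := le_of_mul_le_mul_left h1 hm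
    have h3 : 0 ≤ 4 * M * K * ‖ψ‖ ^ 2 := by positivity
    calc _ ≤ 2 * K * ‖ψ‖ ^ 2 := h2
      _ ≤ _ := by linarith
  · simp_rw [hg]
    exact i2.const_mul _
  · simp_rw [hg]
    rw [integral_const_mul]
    have h1 := mul_nonneg hm.le n1
    have h3 : 0 ≤ 2 * K * h ^ (2 / 3 : ℝ) * ‖ψ‖ ^ 2 := by positivity
    linarith
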